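/- Let $B_n$ be the $n$-strand braid group, generated by $\sigma_1,\dots,\sigma_{n-1}$ with relations $\sigma_i\sigma_j=\sigma_j\sigma_i$ for $|i-j|\ge 2$ and $\sigma_i\sigma_j\sigma_i=\sigma_j\sigma_i\sigma_j$ for $|i-j|=1$, and let $B_n^+$ be the submonoid of $B_n$ generated by $\sigma_1,\dots,\sigma_{n-1}$. For braids $b,b'\in B_n$, write $b<b'$ if $b^{-1}b'$ can be expressed by a word in the letters $\sigma_1^{\pm1},\dots,\sigma_{n-1}^{\pm1}$ in which the generator $\sigma_i$ with the highest index among those that occur appears only positively ($\sigma_i$ occurs, but $\sigma_i^{-1}$ does not), and write $b\le b'$ if $b<b'$ or $b=b'$. Let $\Delta_3=\sigma_1\sigma_2\sigma_1\in B_3^+$. The complexity $\|b\|$ of $b\in B_3^+$ is the least $\ell\in\mathbb{N}$ such that $bb'=\Delta_3^\ell$ for some $b'\in B_3^+$. For $k,\ell\in\mathbb{N}$ put $$S_{k,\ell}=\{\,b\in B_3^+ \mid b\le\Delta_3^k \text{ and } \|b\|\le\ell\,\}.$$ (a) For all integers $\ell\ge k\ge 1$, the set $S_{k,\ell}$ is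 finite, $$\operatorname{card}(S_{k,\ell})=\sum_{m=1}^{k}\binom{\ell+3}{m+1}-k+1,\qquad\text{and}\qquad \operatorname{card}(S_{k,\ell})\le(\ell+3)^{k+2}.$$ (b) For every integer $k\ge 1$ there is a polynomial $P\in\mathbb{Q}[X]$ of degree $k+1$ with leading coefficient $\frac{1}{(k+1)!}$ such that $\operatorname{card}(S_{k,\ell})=P(\ell)$ for all integers $\ell\ge k$; moreover, for all sufficiently large $\ell$, $$\operatorname{card}(S_{k,\ell})\ge\frac12\cdot\frac{\ell^{k+1}}{(k+1)!}.$$ -/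

import Mathlib

namespace Braid

/-- The relators of Artin's presentation of the `n`-strand braid group. The generator
`σ_{i+1}` of the usual numbering `σ_1, …, σ_{n-1}` has the index `i : Fin (n - 1)`. -/
def relators (n : ℕ) : Set (FreeGroup (Fin (n - 1))) :=
  {r | (∃ i j : Fin (n - 1), (i : ℕ) + 2 ≤ j ∧
          r = (FreeGroup.of i * FreeGroup.of j) * (FreeGroup.of j * FreeGroup.of i)⁻¹) ∨
       (∃ i j : Fin (n - 1), (i : ℕ) + 1 = j ∧
          r = (FreeGroup.of i * FreeGroup.of j * FreeGroup.of i) *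
              (FreeGroup.of j * FreeGroup.of i * FreeGroup.of j)⁻¹)}

/-- The `n`-strand braid group `B_n`. -/
abbrev BraidGroup (n : ℕ) : Type := PresentedGroup (relators n)

/-- The Artin generators of `B_n`. -/
def gen {n : ℕ} (i : Fin (n - 1)) : BraidGroup n := PresentedGroup.of i

/-- The braid represented by a braid word: the letter `(i, true)` stands for the generator
with index `i`, and `(i, false)` for its inverse. -/
def evalWord {n : ℕ} (w : List (Fin (n - 1) × Bool)) : BraidGroup n :=
  (w.map fun x => if x.2 then gen x.1 else (gen x.1)⁻¹).prod

/-- The generator with highest index that occurs in the (nonempty) word `w` occurs only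
positively. -/
def MainPositive {n : ℕ} (w : List (Fin (n - 1) × Bool)) : Prop :=
  ∃ i : Fin (n - 1), (∀ x ∈ w, x.1 ≤ i) ∧ (i, true) ∈ w ∧ (i, false) ∉ w

/-- The braid order: `b < b'` holds if `b⁻¹ b'` admits an expression by a braid word in which
the generator with highest index occurs only positively. -/
def BraidLT {n : ℕ} (b b' : BraidGroup n) : Prop :=
  ∃ w : List (Fin (n - 1) × Bool), MainPositive w ∧ evalWord w = b⁻¹ * b'

/-- The reflexive closure of the braid order. -/
def BraidLE {n : ℕ} (b b' : BraidGroup n) : Prop := BraidLT b b' ∨ b = b'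

/-- The monoid `B_n^+` of positive braids: those that have an expression without any inverse
of a generator. -/
def positive (n : ℕ) : Submonoid (BraidGroup n) := Submonoid.closure (Set.range gen)

/-- The generator `σ_1` of `B_3^+`. -/
def s1 : positive 3 := ⟨gen (n := 3) 0, Submonoid.subset_closure ⟨0, rfl⟩⟩

/-- The generator `σ_2` of `B_3^+`. -/
def s2 : positive 3 := ⟨gen (n := 3) 1, Submonoid.subset_closure ⟨1, rfl⟩⟩

/-- Garside's fundamental braid `Δ_3 = σ_1 σ_2 σ_1`. -/
def Delta3 : positive 3 := s1 * s2 * s1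

/-- `a` is a left divisor of `b` in `B_3^+`. -/
def LeftDvd (a b : positive 3) : Prop := ∃ c : positive 3, a * c = b

theorem s1_s2_s1 : s1 * s2 * s1 = s2 * s1 * s2 := by
  apply Subtype.ext
  have h : (PresentedGroup.mk (relators 3)
      ((FreeGroup.of 0 * FreeGroup.of 1 * FreeGroup.of 0) *
        (FreeGroup.of 1 * FreeGroup.of 0 * FreeGroup.of 1)⁻¹)) = 1 :=
    PresentedGroup.one_of_mem (Or.inr ⟨0, 1, by decide, rfl⟩)
  rw [map_mul, map_inv, mul_inv_eq_one] at h
  exact h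

theorem induction_positive {P : positive 3 → Prop} (h1 : P 1)
    (hs1 : ∀ b, P b → P (s1 * b)) (hs2 : ∀ b, P b → P (s2 * b)) (b : positive 3) : P b := by
  obtain ⟨b, hb⟩ := b
  induction hb using Submonoid.closure_induction_left with
  | one => exact h1
  | mul_left x hx y hy ih =>
    obtain ⟨i, rfl⟩ := hx
    match i with
    | ⟨0, _⟩ => exact hs1 ⟨y, hy⟩ ih
    | ⟨1, _⟩ => exact hs2 ⟨y, hy⟩ ih

theorem exists_Delta3_comm (b : positive 3) : ∃ c, b * Delta3 = Delta3 * c := by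
  induction b using induction_positive with
  | h1 => exact ⟨1, by simp⟩
  | hs1 b ih =>
    obtain ⟨c, hc⟩ := ih
    refine ⟨s2 * c, ?_⟩
    rw [mul_assoc, hc, ← mul_assoc, ← mul_assoc]
    congr 1
    rw [Delta3, mul_assoc _ s1 s2, mul_assoc, mul_assoc, ← mul_assoc s2 s1 s2, ← s1_s2_s1]
    simp only [mul_assoc]
  | hs2 b ih =>
    obtain ⟨c, hc⟩ := ih
    refine ⟨s1 * c, ?_⟩
    rw [mul_assoc, hc, ← mul_assoc, ← mul_assoc]
    congr 1
    rw [Delta3, ← mul_assoc, ← mul_assoc, ← s1_s2_s1]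

/-- Every positive 3-strand braid is a left divisor of some power of `Δ_3`. -/
theorem exists_leftDvd_Delta3_pow (b : positive 3) : ∃ l : ℕ, LeftDvd b (Delta3 ^ l) := by
  have key : ∀ x y b : positive 3, x * y = Delta3 → (∃ l : ℕ, LeftDvd b (Delta3 ^ l)) →
      ∃ l : ℕ, LeftDvd (x * b) (Delta3 ^ l) := by
    rintro x y b hxy ⟨l, c, hc⟩
    have hpow : ∀ m : ℕ, ∀ z : positive 3, ∃ z', z * Delta3 ^ m = Delta3 ^ m * z' := by
      intro m
      induction m with
      | zero => exact fun z => ⟨z, by simp⟩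
      | succ m ih =>
        intro z
        obtain ⟨z1, h1⟩ := ih z
        obtain ⟨z2, h2⟩ := exists_Delta3_comm z1
        exact ⟨z2, by rw [pow_succ, ← mul_assoc, h1, mul_assoc, h2, mul_assoc]⟩
    have hpow' : ∃ y', y * Delta3 ^ l = Delta3 ^ l * y' := hpow l y
    obtain ⟨y', hy'⟩ := hpow'
    refine ⟨l + 1, c * y', ?_⟩
    rw [mul_assoc, ← mul_assoc b, hc, ← hy', ← mul_assoc, hxy, ← pow_succ']
  induction b using induction_positive with
  | h1 => exact ⟨0, 1, by simp⟩
  | hs1 b ih => exact key s1 (s2 * s1) b (by rw [Delta3, mul_assoc]) ih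
  | hs2 b ih => exact key s2 (s1 * s2) b (by rw [Delta3, ← mul_assoc, s1_s2_s1]) ih

open Classical in
/-- The (Garside) complexity of a positive 3-strand braid `b`: the least `l` such that `b` is a
left divisor of `Δ_3 ^ l`. -/
noncomputable def complexity (b : positive 3) : ℕ := Nat.find (exists_leftDvd_Delta3_pow b)

/-- The set `S_{k,l}` of all positive 3-strand braids that are at most `Δ_3 ^ k` in the braid
order and have complexity at most `l`. -/
def S (k l : ℕ) : Set (positive 3) :=
  {b | BraidLE (b : BraidGroup 3) ((Delta3 ^ k : positive 3) : BraidGroup 3) ∧ complexity b ≤ l}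

end Braid

/-!
Every braid in `B_3^+` is `Δ_3 ^ d * w` with `w` not divisible by `Δ_3`, and `w` is determined by
its last letter and by the lengths (one or two) of its Garside factors (`simpleProd`). The
generators act on these normal forms from the right by permutations, once `d` is allowed to be
negative, and the braid relation holds; the orbit map `nf` of the trivial braid therefore shows
that normal forms are unique.

Two quantities attached to normal forms are monotone under right multiplication. The number of
factors `sup` does not decrease under positive braids, so the complexity of `w` is its number of
factors (`complexity_simpleProd_le_iff`). The `level`, essentially the number of blocks of equal
letters, is invariant under `σ_1^{±1}` and is not decreased by `σ_2`, so it is monotone for the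
braid order. Conversely, each block of `σ_2` in `w` is absorbed by one factor `Δ_3`, so that for
`1 ≤ k` the braid `w` is at most `Δ_3 ^ k` exactly if its level is at most `k`
(`simpleProd_braidLE_iff`).

Both conditions on `w` now concern a list of Booleans, its length and its number of entries
`true`, and such lists are counted by sums of binomial coefficients (`card_codes`). Splitting
`S (k + 1) (l + 1)` into the multiples of `Δ_3`, which form a copy of `S k l`, and the remaining
braids (`S_succ`) gives a recursion for the cardinality, solved in `ncard_S`.
-/

namespace Braid

/-! ### The normal form of a positive braid -/

/-- The generator of `B_3^+` named by a Boolean: `false` stands for `σ_1`, `true` for `σ_2`. -/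
def letter (i : Bool) : positive 3 := if i then s2 else s1

/-- The Garside normal form of a braid that `Δ_3` does not divide. Its factors are `σ_i` and
`σ_j σ_i` with `j ≠ i`, and each begins with the letter with which the preceding factor ends.
Hence the last letter `i` of the braid and the lengths of the factors determine it: `L` lists
the factors from right to left, `false` for length one and `true` for length two. -/
def simpleProd : Bool → List Bool → positive 3
  | _, [] => 1
  | i, false :: L => simpleProd i L * letter i
  | i, true :: L => simpleProd (!i) L * letter (!i) * letter i

theorem letter_braid (i : Bool) : letter i * letter (!i) * letter i = Delta3 := by
  cases i
  · rfl
  · exact s1_s2_s1.symm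

theorem letter_mul_Delta3 (i : Bool) : letter i * Delta3 = Delta3 * letter (!i) := by
  have h := letter_braid (!i)
  rw [Bool.not_not] at h
  calc letter i * Delta3 = letter i * (letter (!i) * letter i * letter (!i)) := by rw [h]
    _ = letter i * letter (!i) * letter i * letter (!i) := by simp only [mul_assoc]
    _ = Delta3 * letter (!i) := by rw [letter_braid]

theorem simpleProd_mul_Delta3 (i : Bool) (L : List Bool) :
    simpleProd i L * Delta3 = Delta3 * simpleProd (!i) L := by
  induction L generalizing i with
  | nil => simp [simpleProd]
  | cons b L ih =>
    cases b
    · rw [simpleProd, mul_assoc, letter_mul_Delta3, ← mul_assoc, ih, mul_assoc, simpleProd]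
    · rw [simpleProd, mul_assoc, letter_mul_Delta3, ← mul_assoc, mul_assoc (simpleProd _ _),
        letter_mul_Delta3, ← mul_assoc, ih, simpleProd]
      simp only [mul_assoc]

theorem simpleProd_true_cons_mul (i : Bool) (L : List Bool) :
    simpleProd i (true :: L) * letter (!i) = Delta3 * simpleProd i L := by
  have h := letter_braid (!i)
  rw [Bool.not_not] at h
  rw [simpleProd, mul_assoc, mul_assoc, ← mul_assoc (letter (!i)), h, simpleProd_mul_Delta3,
    Bool.not_not]

theorem positive_induction_right {P : positive 3 → Prop} (h1 : P 1)
    (hmul : ∀ b i, P b → P (b * letter i)) (b : positive 3) : P b := by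
  obtain ⟨b, hb⟩ := b
  induction hb using Submonoid.closure_induction_right with
  | one => exact h1
  | mul_right x hx y hy ih =>
    obtain ⟨i, rfl⟩ := hy
    match i with
    | ⟨0, _⟩ => exact hmul ⟨x, hx⟩ false ih
    | ⟨1, _⟩ => exact hmul ⟨x, hx⟩ true ih

theorem eq_Delta3_mul_or_eq_simpleProd (b : positive 3) :
    (∃ b', b = Delta3 * b') ∨ ∃ i L, b = simpleProd i L := by
  induction b using positive_induction_right with
  | h1 => exact Or.inr ⟨true, [], rfl⟩
  | hmul b j ih =>
    rcases ih with ⟨b', rfl⟩ | ⟨i, L, rfl⟩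
    · exact Or.inl ⟨b' * letter j, by rw [mul_assoc]⟩
    · rcases Bool.eq_or_eq_not j i with rfl | rfl
      · exact Or.inr ⟨j, false :: L, rfl⟩
      · match L with
        | [] => exact Or.inr ⟨!i, [false], rfl⟩
        | false :: L => exact Or.inr ⟨!i, true :: L, by simp [simpleProd]⟩
        | true :: L => exact Or.inl ⟨_, simpleProd_true_cons_mul i L⟩

/-! ### The right action on normal forms -/

/-- The words of length codes behind the braids that `Δ_3` does not divide: `one` for the
trivial braid, and `more i b L` for `simpleProd i (b :: L)`. -/
inductive Word
  | one
  | more (i b : Bool) (L : List Bool)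

/-- The word of `simpleProd i L`; for an empty list the letter `i` is forgotten. -/
def Word.mk (i : Bool) : List Bool → Word
  | [] => .one
  | b :: L => .more i b L

/-- The right multiplication of `Δ_3 ^ d * w`, encoded as `(d, w)`, by the generator `letter j`. -/
def step (j : Bool) : ℤ × Word → ℤ × Word
  | (d, .one) => (d, .more j false [])
  | (d, .more i b L) =>
    if i = j then (d, .more j false (b :: L))
    else if b then (d + 1, Word.mk i L) else (d, .more j true L)

/-- The right multiplication by the inverse of the generator `letter j`. -/
def stepInv (j : Bool) : ℤ × Word → ℤ × Word
  | (d, .one) => (d - 1, .more (!j) true [])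
  | (d, .more i b L) =>
    if i = j then (if b then (d, .more (!j) false L) else (d, Word.mk j L))
    else (d - 1, .more i true (b :: L))

theorem stepInv_step (j : Bool) (x : ℤ × Word) : stepInv j (step j x) = x := by
  obtain ⟨d, _ | ⟨i, b, L⟩⟩ := x
  · simp [step, stepInv, Word.mk]
  · rcases L with _ | ⟨c, L⟩ <;> cases i <;> cases j <;> cases b <;>
      simp [step, stepInv, Word.mk]

theorem step_stepInv (j : Bool) (x : ℤ × Word) : step j (stepInv j x) = x := by
  obtain ⟨d, _ | ⟨i, b, L⟩⟩ := x
  · simp [step, stepInv, Word.mk]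
  · rcases L with _ | ⟨c, L⟩ <;> cases i <;> cases j <;> cases b <;>
      simp [step, stepInv, Word.mk]

theorem step_braid (x : ℤ × Word) :
    step false (step true (step false x)) = step true (step false (step true x)) := by
  obtain ⟨d, _ | ⟨i, b, L⟩⟩ := x
  · simp [step, Word.mk]
  · rcases L with _ | ⟨c, L⟩ <;> cases i <;> cases b <;> simp [step, Word.mk]

/-- The permutation of normal forms given by right multiplication by `letter j`. -/
def stepPerm (j : Bool) : Equiv.Perm (ℤ × Word) :=
  ⟨step j, stepInv j, stepInv_step j, step_stepInv j⟩

/-- The right action of `B_3` on normal forms. -/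
def action : BraidGroup 3 →* (Equiv.Perm (ℤ × Word))ᵐᵒᵖ :=
  PresentedGroup.toGroup (f := fun i : Fin (3 - 1) => MulOpposite.op (stepPerm (decide (i = 1))))
    (by
      rintro r (⟨i, j, hij, rfl⟩ | ⟨i, j, hij, rfl⟩)
      · omega
      · obtain rfl : i = 0 := by ext; simp; omega
        obtain rfl : j = 1 := by ext; simp at hij ⊢; omega
        rw [map_mul, map_inv, mul_inv_eq_one]
        simp only [map_mul, FreeGroup.lift_apply_of]
        rw [← MulOpposite.op_mul, ← MulOpposite.op_mul, ← MulOpposite.op_mul, ← MulOpposite.op_mul]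
        congr 1
        ext1 x
        exact step_braid x)

/-- The normal form of a braid: its action on the normal form of the trivial braid. -/
def nf (b : BraidGroup 3) : ℤ × Word := (action b).unop (0, .one)

theorem nf_one : nf 1 = (0, .one) := by simp [nf]

theorem action_letter (j : Bool) : action (letter j : positive 3) = .op (stepPerm j) := by
  cases j <;> exact PresentedGroup.toGroup.of _

theorem nf_mul_letter (b : BraidGroup 3) (j : Bool) :
    nf (b * (letter j : positive 3)) = step j (nf b) := by
  rw [nf, map_mul, action_letter]; rfl

theorem nf_mul_letter_inv (b : BraidGroup 3) (j : Bool) :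
    nf (b * ((letter j : positive 3) : BraidGroup 3)⁻¹) = stepInv j (nf b) := by
  rw [nf, map_mul, map_inv, action_letter]; rfl

theorem step_mk_self (d : ℤ) (i : Bool) (L : List Bool) :
    step i (d, Word.mk i L) = (d, Word.mk i (false :: L)) := by
  cases L <;> simp [step, Word.mk]

theorem nf_simpleProd (i : Bool) (L : List Bool) :
    nf (simpleProd i L : positive 3) = (0, Word.mk i L) := by
  induction L generalizing i with
  | nil => simpa [simpleProd, Word.mk] using nf_one
  | cons b L ih =>
    cases b
    · rw [simpleProd, Submonoid.coe_mul, nf_mul_letter, ih, step_mk_self]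
    · rw [simpleProd, Submonoid.coe_mul, nf_mul_letter, Submonoid.coe_mul, nf_mul_letter, ih,
        step_mk_self]
      cases i <;> simp [step, Word.mk]

theorem step_shift (j : Bool) (d : ℤ) (w : Word) :
    step j (d + 1, w) = ((step j (d, w)).1 + 1, (step j (d, w)).2) := by
  rcases w with _ | ⟨i, b, L⟩
  · rfl
  · cases i <;> cases j <;> cases b <;> rfl

theorem nf_Delta3_mul (b : positive 3) :
    nf ((Delta3 * b : positive 3) : BraidGroup 3) = ((nf b).1 + 1, (nf b).2) := by
  induction b using positive_induction_right with
  | h1 =>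
    rw [Submonoid.coe_one, nf_one, mul_one, ← letter_braid true, Submonoid.coe_mul, nf_mul_letter,
      Submonoid.coe_mul, nf_mul_letter, ← one_mul ((letter true : positive 3) : BraidGroup 3),
      nf_mul_letter, nf_one]
    rfl
  | hmul b j ih =>
    rw [← mul_assoc, Submonoid.coe_mul, nf_mul_letter, ih, Submonoid.coe_mul, nf_mul_letter,
      step_shift]

theorem nf_Delta3_pow (m : ℕ) : nf ((Delta3 ^ m : positive 3) : BraidGroup 3) =
    ((m : ℤ), Word.one) := by
  induction m with
  | zero => simpa using nf_one
  | succ m ih => rw [pow_succ', nf_Delta3_mul, ih]; simp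

/-! ### Monotone quantities -/

/-- A function on normal forms that no generator decreases is monotone along right
multiplication by positive braids. -/
theorem nf_mono_of_step {F : ℤ × Word → ℤ} (hF : ∀ j x, F x ≤ F (step j x)) (b : BraidGroup 3)
    (c : positive 3) : F (nf b) ≤ F (nf (b * c)) := by
  induction c using positive_induction_right with
  | h1 => simp
  | hmul c j ih =>
    rw [Submonoid.coe_mul, ← mul_assoc, nf_mul_letter]
    exact ih.trans (hF j _)

theorem fst_le_step (j : Bool) (x : ℤ × Word) : x.1 ≤ (step j x).1 := by
  obtain ⟨d, _ | ⟨i, b, L⟩⟩ := x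
  · simp [step]
  · cases i <;> cases j <;> cases b <;> simp [step]

/-- The number of factors of a normal form, `Δ_3` included. -/
def sup : ℤ × Word → ℤ
  | (d, .one) => d
  | (d, .more _ _ L) => d + (L.length + 1)

theorem sup_mk (d : ℤ) (i : Bool) (L : List Bool) : sup (d, Word.mk i L) = d + L.length := by
  cases L <;> simp [sup, Word.mk]

theorem sup_le_step (j : Bool) (x : ℤ × Word) : sup x ≤ sup (step j x) := by
  obtain ⟨d, _ | ⟨i, b, L⟩⟩ := x
  · simp [step, sup]
  · rcases L with _ | ⟨c, L⟩ <;> cases i <;> cases j <;> cases b <;>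
      simp [step, sup, Word.mk] <;> omega

/-- The level of a normal form: it locates a braid among the powers of `Δ_3` in the braid order.
It is invariant under right multiplication by `σ_1`, and `σ_2` does not decrease it. -/
def level : ℤ × Word → ℤ
  | (d, .one) => d
  | (d, .more i b L) =>
    d + (b :: L).count true + if i = true ∧ false ∈ b :: L then 1 else 0

theorem level_mk (d : ℤ) (i : Bool) (L : List Bool) :
    level (d, Word.mk i L) = d + L.count true + if i = true ∧ false ∈ L then 1 else 0 := by
  cases L <;> simp [level, Word.mk]

theorem level_step_false (x : ℤ × Word) : level (step false x) = level x := by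
  obtain ⟨d, _ | ⟨i, b, L⟩⟩ := x
  · simp [step, level]
  · rcases L with _ | ⟨c, L⟩ <;> cases i <;> cases b <;> simp [step, level, Word.mk] <;> omega

theorem level_step_true (x : ℤ × Word) : level x ≤ level (step true x) := by
  obtain ⟨d, _ | ⟨i, b, L⟩⟩ := x
  · simp [step, level]
  · rcases L with _ | ⟨c, L⟩ <;> cases i <;> cases b <;> simp [step, level, Word.mk] <;>
      (try split_ifs) <;> omega

theorem level_stepInv_false (x : ℤ × Word) : level (stepInv false x) = level x := by
  rw [← level_step_false, step_stepInv]

/-! ### Complexity -/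

theorem complexity_le_iff {b : positive 3} {l : ℕ} :
    complexity b ≤ l ↔ ∃ m ≤ l, LeftDvd b (Delta3 ^ m) := by
  classical
  unfold complexity
  exact Nat.find_le_iff _ _

theorem positive_mul_left_cancel {a b c : positive 3} (h : a * b = a * c) : b = c := by
  apply Subtype.ext
  have := congrArg (Subtype.val) h
  simpa using this

theorem fst_nf_nonneg (b : positive 3) : 0 ≤ (nf b).1 := by
  simpa [nf_one] using nf_mono_of_step (F := Prod.fst) fst_le_step 1 b

theorem Delta3_mul_ne_simpleProd (b : positive 3) (i : Bool) (L : List Bool) :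
    Delta3 * b ≠ simpleProd i L := by
  intro h
  have h1 := nf_Delta3_mul b
  rw [h, nf_simpleProd] at h1
  have h2 := fst_nf_nonneg b
  have h3 := congrArg Prod.fst h1
  simp only at h3
  omega

theorem complexity_Delta3_mul_le_iff {b : positive 3} {l : ℕ} :
    complexity (Delta3 * b) ≤ l + 1 ↔ complexity b ≤ l := by
  rw [complexity_le_iff, complexity_le_iff]
  constructor
  · rintro ⟨m, hm, c, hc⟩
    rw [mul_assoc] at hc
    cases m with
    | zero => exact absurd hc (Delta3_mul_ne_simpleProd (b * c) true [])
    | succ m =>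
      rw [pow_succ'] at hc
      exact ⟨m, by omega, c, positive_mul_left_cancel hc⟩
  · rintro ⟨m, hm, c, hc⟩
    exact ⟨m + 1, by omega, c, by rw [mul_assoc, hc, pow_succ']⟩

theorem complexity_zero {b : positive 3} (h : complexity b ≤ 0) : b = 1 := by
  obtain ⟨m, hm, c, hc⟩ := complexity_le_iff.1 h
  obtain rfl : m = 0 := by omega
  rcases eq_Delta3_mul_or_eq_simpleProd b with ⟨b', rfl⟩ | ⟨i, L, rfl⟩
  · rw [mul_assoc] at hc
    exact absurd hc (Delta3_mul_ne_simpleProd _ true [])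
  · have h1 := nf_mono_of_step sup_le_step (simpleProd i L : positive 3) c
    rw [← Submonoid.coe_mul, hc, nf_simpleProd, sup_mk, pow_zero, Submonoid.coe_one, nf_one] at h1
    have : L = [] := by
      rw [← List.length_eq_zero_iff]
      simp only [sup] at h1
      omega
    subst this
    rfl

theorem simpleProd_leftDvd (i : Bool) (L : List Bool) :
    LeftDvd (simpleProd i L) (Delta3 ^ L.length) := by
  -- If `a` divides `Δ_3 ^ m` and `x` divides `Δ_3`, then `a * x` divides `Δ_3 ^ (m + 1)`.
  have key (a x y : positive 3) (m : ℕ) (hxy : x * y = Delta3) (ha : LeftDvd a (Delta3 ^ m)) :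
      LeftDvd (a * x) (Delta3 ^ (m + 1)) := by
    obtain ⟨c, hc⟩ := ha
    obtain ⟨c', hc'⟩ := exists_Delta3_comm c
    exact ⟨y * c', by rw [mul_assoc, ← mul_assoc x, hxy, ← hc', ← mul_assoc, hc, pow_succ]⟩
  induction L generalizing i with
  | nil => exact ⟨1, by simp [simpleProd]⟩
  | cons b L ih =>
    have h := letter_braid i
    cases b
    · exact key _ _ (letter (!i) * letter i) _ (by rw [← mul_assoc, h]) (ih i)
    · rw [simpleProd, mul_assoc]
      have h' := letter_braid (!i)
      rw [Bool.not_not] at h'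
      exact key _ _ (letter (!i)) _ h' (ih _)

theorem complexity_simpleProd_le_iff {i : Bool} {L : List Bool} {l : ℕ} :
    complexity (simpleProd i L) ≤ l ↔ L.length ≤ l := by
  rw [complexity_le_iff]
  refine ⟨?_, fun h => ⟨_, h, simpleProd_leftDvd i L⟩⟩
  rintro ⟨m, hm, c, hc⟩
  have h1 := nf_mono_of_step sup_le_step (simpleProd i L : positive 3) c
  rw [← Submonoid.coe_mul, hc, nf_simpleProd, sup_mk, nf_Delta3_pow] at h1
  simp only [sup] at h1
  omega

/-! ### The braid order below a power of `Δ_3` -/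

/-- The braids that have an expression with no letter `σ_2⁻¹`. -/
def Nonneg (p : BraidGroup 3) : Prop :=
  ∃ w : List (Fin (3 - 1) × Bool), (1, false) ∉ w ∧ evalWord w = p

/-- The braids that have an expression with a letter `σ_2` and no letter `σ_2⁻¹`. -/
def Pos (p : BraidGroup 3) : Prop :=
  ∃ w : List (Fin (3 - 1) × Bool), (1, true) ∈ w ∧ (1, false) ∉ w ∧ evalWord w = p

theorem evalWord_append {n : ℕ} (v w : List (Fin (n - 1) × Bool)) :
    evalWord (v ++ w) = evalWord v * evalWord w := by
  simp [evalWord]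

theorem evalWord_cons {n : ℕ} (x : Fin (n - 1) × Bool) (w : List (Fin (n - 1) × Bool)) :
    evalWord (x :: w) = (if x.2 then gen x.1 else (gen x.1)⁻¹) * evalWord w := by
  simp [evalWord]

theorem Pos.nonneg {p : BraidGroup 3} (h : Pos p) : Nonneg p :=
  let ⟨w, _, h2, h3⟩ := h
  ⟨w, h2, h3⟩

theorem Nonneg.mul {p q : BraidGroup 3} (hp : Nonneg p) (hq : Nonneg q) : Nonneg (p * q) := by
  obtain ⟨v, hv, rfl⟩ := hp
  obtain ⟨w, hw, rfl⟩ := hq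
  exact ⟨v ++ w, by simp [hv, hw], evalWord_append v w⟩

theorem Nonneg.mul_pos {p q : BraidGroup 3} (hp : Nonneg p) (hq : Pos q) : Pos (p * q) := by
  obtain ⟨v, hv, rfl⟩ := hp
  obtain ⟨w, hw, hw', rfl⟩ := hq
  exact ⟨v ++ w, by simp [hw], by simp [hv, hw'], evalWord_append v w⟩

theorem Pos.mul_nonneg {p q : BraidGroup 3} (hp : Pos p) (hq : Nonneg q) : Pos (p * q) := by
  obtain ⟨v, hv, hv', rfl⟩ := hp
  obtain ⟨w, hw, rfl⟩ := hq
  exact ⟨v ++ w, by simp [hv], by simp [hv', hw], evalWord_append v w⟩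

theorem nonneg_letter (i : Bool) : Nonneg (letter i : positive 3) := by
  cases i
  · exact ⟨[(0, true)], by simp, by simp [evalWord, letter, s1]⟩
  · exact ⟨[(1, true)], by simp, by simp [evalWord, letter, s2]⟩

theorem nonneg_letter_false_inv : Nonneg ((letter false : positive 3) : BraidGroup 3)⁻¹ :=
  ⟨[(0, false)], by simp, by simp [evalWord, letter, s1]⟩

theorem pos_letter_true : Pos (letter true : positive 3) :=
  ⟨[(1, true)], by simp, by simp, by simp [evalWord, letter, s2]⟩

theorem nonneg_coe (b : positive 3) : Nonneg b := by
  induction b using positive_induction_right with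
  | h1 => exact ⟨[], by simp, rfl⟩
  | hmul b j ih => exact ih.mul (nonneg_letter j)

theorem pos_Delta3 : Pos (Delta3 : positive 3) := by
  rw [← letter_braid false]
  exact ((nonneg_letter false).mul_pos pos_letter_true).mul_nonneg (nonneg_letter false)

theorem pos_Delta3_pow {k : ℕ} (hk : 1 ≤ k) : Pos ((Delta3 ^ k : positive 3) : BraidGroup 3) := by
  obtain ⟨k, rfl⟩ := Nat.exists_eq_add_of_le' hk
  rw [pow_succ', Submonoid.coe_mul]
  exact pos_Delta3.mul_nonneg (nonneg_coe _)

theorem Pos.braidLT {b b' : BraidGroup 3} (h : Pos (b⁻¹ * b')) : BraidLT b b' := by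
  obtain ⟨w, h1, h2, h3⟩ := h
  exact ⟨w, ⟨1, fun x _ => Nat.le_of_lt_succ x.1.isLt, h1, h2⟩, h3⟩

theorem level_nf_le_of_nonneg (b : BraidGroup 3) {p : BraidGroup 3} (hp : Nonneg p) :
    level (nf b) ≤ level (nf (b * p)) := by
  obtain ⟨w, hw, rfl⟩ := hp
  induction w generalizing b with
  | nil => simp [evalWord]
  | cons x w ih =>
    rw [evalWord_cons, ← mul_assoc]
    refine le_trans ?_ (ih _ fun h => hw (List.mem_cons_of_mem _ h))
    match x with
    | (⟨0, _⟩, true) => exact (nf_mul_letter b false ▸ level_step_false _).ge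
    | (⟨0, _⟩, false) => exact (nf_mul_letter_inv b false ▸ level_stepInv_false _).ge
    | (⟨1, _⟩, true) => exact (nf_mul_letter b true ▸ level_step_true _)
    | (⟨1, _⟩, false) => exact absurd List.mem_cons_self hw

/-- A word whose letters are all `σ_1` represents a power of `σ_1`. -/
theorem evalWord_eq_pow {w : List (Fin (3 - 1) × Bool)} (h : ∀ x ∈ w, x = (0, true)) :
    evalWord w = ((letter false ^ w.length : positive 3) : BraidGroup 3) := by
  induction w with
  | nil => rfl
  | cons x w ih =>
    rw [evalWord_cons, ih fun y hy => h y (List.mem_cons_of_mem _ hy),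
      h x List.mem_cons_self, List.length_cons, pow_succ', Submonoid.coe_mul]
    rfl

/-- The two ways of being smaller: the quotient is positive in `σ_2`, or a power of `σ_1`. -/
theorem BraidLT.pos_or_pow {b b' : BraidGroup 3} (h : BraidLT b b') :
    Pos (b⁻¹ * b') ∨
      ∃ n : ℕ, b⁻¹ * b' = ((letter false ^ (n + 1) : positive 3) : BraidGroup 3) := by
  obtain ⟨w, ⟨i, hi, hp, hn⟩, hw⟩ := h
  match i with
  | ⟨1, _⟩ => exact Or.inl ⟨w, hp, hn, hw⟩
  | ⟨0, _⟩ =>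
    right
    have hall : ∀ x ∈ w, x = (0, true) := by
      rintro ⟨j, b⟩ hx
      have hj : j = 0 := Fin.ext (Nat.le_zero.1 (hi _ hx))
      subst hj
      cases b
      · exact absurd hx hn
      · rfl
    have hlen : 0 < w.length := List.length_pos_of_mem hp
    refine ⟨w.length - 1, ?_⟩
    rw [← hw, evalWord_eq_pow hall, Nat.sub_add_cancel hlen]

theorem BraidLE.level_le {b b' : BraidGroup 3} (h : BraidLE b b') :
    level (nf b) ≤ level (nf b') := by
  rcases h with h | rfl
  · have hp : Nonneg (b⁻¹ * b') := by
      rcases h.pos_or_pow with h | ⟨n, h⟩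
      · exact h.nonneg
      · rw [h]; exact nonneg_coe _
    simpa using level_nf_le_of_nonneg b hp
  · exact le_rfl

/-- A braid positive in `σ_2` is nontrivial: a conjugate begins with `σ_2`, which raises the
level of the trivial braid. -/
theorem Pos.ne_one {p : BraidGroup 3} (h : Pos p) : p ≠ 1 := by
  obtain ⟨w, hp, hn, rfl⟩ := h
  intro h1
  obtain ⟨u, v, rfl⟩ := List.append_of_mem hp
  have hvu : Nonneg (evalWord (v ++ u)) :=
    ⟨v ++ u, by simp at hn ⊢; exact ⟨hn.2, hn.1⟩, rfl⟩
  have h2 : (letter true : positive 3) * evalWord (v ++ u) = (1 : BraidGroup 3) := by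
    rw [evalWord_append, evalWord_cons] at h1
    rw [evalWord_append, ← mul_assoc]
    exact mul_eq_one_comm.1 h1
  have h3 := level_nf_le_of_nonneg (letter true : positive 3) hvu
  rw [h2, nf_one, ← one_mul ((letter true : positive 3) : BraidGroup 3), nf_mul_letter,
    nf_one] at h3
  simp [step, level] at h3

theorem braidLE_one_iff {b : positive 3} : BraidLE (b : BraidGroup 3) 1 ↔ b = 1 := by
  constructor
  · rintro (h | h)
    · rcases h.pos_or_pow with h | ⟨n, h⟩
      · exact absurd (by simp) ((nonneg_coe b).mul_pos h).ne_one
      · have h1 : b * letter false ^ (n + 1) = 1 := by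
          apply Subtype.ext
          rw [Submonoid.coe_mul, ← h]
          simp
        exact complexity_zero (complexity_le_iff.2 ⟨0, le_rfl, _, by rw [h1, pow_zero]⟩)
    · exact Subtype.ext h
  · rintro rfl
    exact Or.inr rfl

theorem braidLE_mul_left_iff {a b c : BraidGroup 3} : BraidLE (a * b) (a * c) ↔ BraidLE b c := by
  simp only [BraidLE, BraidLT, mul_inv_rev, mul_assoc, inv_mul_cancel_left, mul_right_inj]

theorem letter_inv_mul_Delta3 (i : Bool) :
    ((letter i : positive 3) : BraidGroup 3)⁻¹ * (Delta3 : positive 3) =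
      (Delta3 : positive 3) * ((letter (!i) : positive 3) : BraidGroup 3)⁻¹ := by
  rw [inv_mul_eq_iff_eq_mul, ← mul_assoc, eq_mul_inv_iff_mul_eq]
  have h := congrArg (Subtype.val) (letter_mul_Delta3 i)
  exact h.symm

theorem letter_inv_pow_mul_Delta3 (n : ℕ) :
    ((letter true : positive 3) : BraidGroup 3)⁻¹ ^ n * (Delta3 : positive 3) =
      (Delta3 : positive 3) * ((letter false : positive 3) : BraidGroup 3)⁻¹ ^ n := by
  induction n with
  | zero => simp
  | succ n ih =>
    rw [pow_succ, mul_assoc, letter_inv_mul_Delta3, ← mul_assoc, ih, mul_assoc, Bool.not_true,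
      ← pow_succ]

theorem simpleProd_inv_mul_Delta3 (i : Bool) (L : List Bool) :
    ((simpleProd i L : positive 3) : BraidGroup 3)⁻¹ * (Delta3 : positive 3) =
      (Delta3 : positive 3) * ((simpleProd (!i) L : positive 3) : BraidGroup 3)⁻¹ := by
  rw [inv_mul_eq_iff_eq_mul, ← mul_assoc, eq_mul_inv_iff_mul_eq]
  exact (congrArg (Subtype.val) (simpleProd_mul_Delta3 i L)).symm

theorem nonneg_letter_false_inv_pow (n : ℕ) :
    Nonneg (((letter false : positive 3) : BraidGroup 3)⁻¹ ^ n) := by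
  induction n with
  | zero => exact ⟨[], by simp, rfl⟩
  | succ n ih => rw [pow_succ]; exact ih.mul nonneg_letter_false_inv

/-- Each block of letters `σ_2⁻¹` is absorbed by one factor `Δ_3`, which exchanges `σ_1`
and `σ_2`. -/
theorem pos_of_count_lt {L : List Bool} {k : ℕ} (h : L.count true < k) (n : ℕ) :
    Pos (((letter true : positive 3) : BraidGroup 3)⁻¹ ^ n *
      (((simpleProd true L : positive 3) : BraidGroup 3)⁻¹ * (Delta3 ^ k : positive 3))) := by
  induction L generalizing k n with
  | nil =>
    obtain ⟨k, rfl⟩ := Nat.exists_eq_add_of_le' (show 1 ≤ k by omega)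
    rw [simpleProd, Submonoid.coe_one, inv_one, one_mul, pow_succ', Submonoid.coe_mul, ← mul_assoc,
      letter_inv_pow_mul_Delta3, mul_assoc]
    exact pos_Delta3.mul_nonneg ((nonneg_letter_false_inv_pow n).mul (nonneg_coe _))
  | cons b L ih =>
    cases b
    · rw [simpleProd, Submonoid.coe_mul, mul_inv_rev, mul_assoc, ← mul_assoc (_ ^ n), ← pow_succ]
      exact ih (by simpa using h) (n + 1)
    · rw [List.count_cons_self] at h
      obtain ⟨k, rfl⟩ := Nat.exists_eq_add_of_le' (show 1 ≤ k by omega)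
      have h1 := ih (show L.count true < k by omega) 1
      rw [pow_one] at h1
      have h2 : ((letter true : positive 3) : BraidGroup 3)⁻¹ ^ n *
          (((simpleProd true (true :: L) : positive 3) : BraidGroup 3)⁻¹ *
            (Delta3 ^ (k + 1) : positive 3)) =
          (Delta3 : positive 3) * ((((letter false : positive 3) : BraidGroup 3)⁻¹ ^ (n + 1)) *
            (((letter true : positive 3) : BraidGroup 3)⁻¹ *
            (((simpleProd true L : positive 3) : BraidGroup 3)⁻¹ *
              (Delta3 ^ k : positive 3)))) := by
        have hg := simpleProd_inv_mul_Delta3 false L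
        have hb := letter_inv_mul_Delta3 false
        have hn := letter_inv_pow_mul_Delta3 (n + 1)
        rw [Bool.not_false] at hg hb
        rw [simpleProd, Bool.not_true, pow_succ' Delta3]
        simp only [Submonoid.coe_mul]
        generalize ((letter true : positive 3) : BraidGroup 3) = a at *
        generalize ((letter false : positive 3) : BraidGroup 3) = b at *
        generalize ((simpleProd false L : positive 3) : BraidGroup 3) = g at *
        generalize ((simpleProd true L : positive 3) : BraidGroup 3) = g' at *
        generalize (Delta3 : BraidGroup 3) = D at *
        generalize ((Delta3 ^ k : positive 3) : BraidGroup 3) = P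
        calc a⁻¹ ^ n * ((g * b * a)⁻¹ * (D * P))
            = a⁻¹ ^ (n + 1) * (b⁻¹ * (g⁻¹ * D) * P) := by
              simp only [mul_inv_rev, mul_assoc, pow_succ]
          _ = a⁻¹ ^ (n + 1) * (b⁻¹ * D * g'⁻¹ * P) := by rw [hg]; simp only [mul_assoc]
          _ = a⁻¹ ^ (n + 1) * D * (a⁻¹ * (g'⁻¹ * P)) := by rw [hb]; simp only [mul_assoc]
          _ = D * (b⁻¹ ^ (n + 1) * (a⁻¹ * (g'⁻¹ * P))) := by rw [hn, mul_assoc]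
      rw [h2]
      exact pos_Delta3.nonneg.mul_pos ((nonneg_letter_false_inv_pow _).mul_pos h1)

theorem pos_of_count_le {L : List Bool} {k : ℕ} (hk : 1 ≤ k) (h : L.count true ≤ k) :
    Pos (((simpleProd false L : positive 3) : BraidGroup 3)⁻¹ * (Delta3 ^ k : positive 3)) := by
  induction L with
  | nil => simpa [simpleProd] using pos_Delta3_pow hk
  | cons b L ih =>
    cases b
    · rw [simpleProd, Submonoid.coe_mul, mul_inv_rev, mul_assoc]
      exact nonneg_letter_false_inv.mul_pos (ih (by simpa using h))
    · rw [List.count_cons_self] at h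
      have h1 := pos_of_count_lt (show L.count true < k by omega) 1
      rw [simpleProd, Submonoid.coe_mul, mul_inv_rev, Submonoid.coe_mul, mul_inv_rev, mul_assoc,
        mul_assoc]
      rw [pow_one] at h1
      exact nonneg_letter_false_inv.mul_pos h1

/-- This braid has the level of `Δ_3 ^ k` and lies just below it: the two differ by a power of
`σ_1`. -/
theorem simpleProd_replicate_mul (k : ℕ) :
    simpleProd true (List.replicate k true) * letter false ^ k = Delta3 ^ k := by
  induction k with
  | zero => rfl
  | succ k ih =>
    rw [List.replicate_succ, pow_succ', ← mul_assoc, ← Bool.not_true, simpleProd_true_cons_mul,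
      mul_assoc, Bool.not_true, ih, pow_succ']

theorem braidLE_replicate {n k : ℕ} (h : n ≤ k) :
    BraidLE ((simpleProd true (List.replicate n true) : positive 3) : BraidGroup 3)
      (Delta3 ^ k : positive 3) := by
  rcases h.lt_or_eq with h | rfl
  · have := pos_of_count_lt (L := List.replicate n true) (k := k) (by simpa using h) 0
    rw [pow_zero, one_mul] at this
    exact Or.inl this.braidLT
  · rcases Nat.eq_zero_or_pos n with rfl | hn
    · exact Or.inr rfl
    · refine Or.inl ⟨List.replicate n (0, true), ⟨0, ?_, ?_, ?_⟩, ?_⟩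
      · intro x hx
        rw [List.eq_of_mem_replicate hx]
      · simp; omega
      · simp
      · rw [evalWord_eq_pow fun x hx => List.eq_of_mem_replicate hx, List.length_replicate,
          eq_inv_mul_iff_mul_eq, ← Submonoid.coe_mul, simpleProd_replicate_mul]

/-- The level decides the comparison with a power of `Δ_3`. -/
theorem simpleProd_braidLE_iff {i : Bool} {L : List Bool} {k : ℕ} (hk : 1 ≤ k) :
    BraidLE ((simpleProd i L : positive 3) : BraidGroup 3) (Delta3 ^ k : positive 3) ↔
      L.count true + (if i = true ∧ false ∈ L then 1 else 0) ≤ k := by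
  constructor
  · intro h
    have h1 := h.level_le
    rw [nf_simpleProd, level_mk, nf_Delta3_pow] at h1
    simp only [level] at h1
    split_ifs at h1 ⊢ <;> omega
  · intro h
    cases i
    · exact Or.inl (pos_of_count_le hk (by simpa using h)).braidLT
    · by_cases hL : false ∈ L
      · have := pos_of_count_lt (L := L) (k := k) (by simpa [hL] using h) 0
        rw [pow_zero, one_mul] at this
        exact Or.inl this.braidLT
      · have hrep : L = List.replicate L.length true := by
          refine List.eq_replicate_of_mem fun b hb => ?_
          cases b
          · exact absurd hb hL
          · rfl
        rw [hrep] at h ⊢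
        exact braidLE_replicate (by simpa using h)

/-! ### Counting -/

/-- The lists of Booleans of length at most `l` with at most `k` entries `true`. -/
def codes : ℕ → ℕ → Finset (List Bool)
  | 0, _ => {[]}
  | l + 1, 0 => insert [] ((codes l 0).image (List.cons false))
  | l + 1, k + 1 =>
    insert [] ((codes l (k + 1)).image (List.cons false) ∪ (codes l k).image (List.cons true))

theorem mem_codes {l k : ℕ} {L : List Bool} :
    L ∈ codes l k ↔ L.length ≤ l ∧ L.count true ≤ k := by
  induction l, k using codes.induct generalizing L with
  | case1 k =>
    cases L <;> simp [codes]
  | case2 l ih =>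
    rcases L with _ | ⟨_ | _, L⟩ <;> simp [codes, ih]
  | case3 l k ih1 ih2 =>
    rcases L with _ | ⟨_ | _, L⟩ <;> simp [codes, ih1, ih2]

/-- Splitting off the first entry gives Pascal's recursion for the partial sums of a row of
binomial coefficients. -/
theorem card_codes (l k : ℕ) :
    (codes l k).card = ∑ j ∈ Finset.range (k + 1), (l + 1).choose (j + 1) := by
  have hinj (b : Bool) : Function.Injective (List.cons b) := List.cons_injective
  induction l, k using codes.induct with
  | case1 k =>
    rw [Finset.sum_range_succ', Finset.sum_eq_zero]
    · simp [codes]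
    · intro j _
      exact Nat.choose_eq_zero_of_lt (by omega)
  | case2 l ih =>
    rw [codes, Finset.card_insert_of_notMem (by simp), Finset.card_image_of_injective _ (hinj _),
      ih]
    simp
  | case3 l k ih1 ih2 =>
    rw [codes, Finset.card_insert_of_notMem (by simp), Finset.card_union_of_disjoint,
      Finset.card_image_of_injective _ (hinj _), Finset.card_image_of_injective _ (hinj _),
      ih1, ih2]
    · have (j : ℕ) : (l + 1 + 1).choose (j + 1) = (l + 1).choose j + (l + 1).choose (j + 1) :=
        Nat.choose_succ_succ _ _
      simp only [this, Finset.sum_add_distrib]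
      -- The term `j = 0` of the first sum counts the empty list.
      rw [Finset.sum_range_succ' (fun j => (l + 1).choose j)]
      simp
      omega
    · rw [Finset.disjoint_left]
      simp

/-- The normal forms of the elements of `S k l` that `Δ_3` does not divide, for `1 ≤ k`. The
trivial braid is represented with the letter `false` only; the level of the lists with letter
`true` and no entry `false` is smaller by one, which adds the list of `k` entries `true`. -/
def normalCodes (k l : ℕ) : Finset (Bool × List Bool) :=
  (codes l k).image (Prod.mk false) ∪
    (insert (List.replicate k true) ((codes l (k - 1)).erase [])).image (Prod.mk true)

theorem card_normalCodes {k l : ℕ} (hk : 1 ≤ k) :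
    (normalCodes k l).card + 1 = (codes (l + 1) k).card := by
  obtain ⟨k, rfl⟩ := Nat.exists_eq_add_of_le' hk
  have hinj (b : Bool) : Function.Injective (Prod.mk b : List Bool → _) :=
    Prod.mk_right_injective b
  have hnil : [] ∈ codes l k := mem_codes.2 (by simp)
  have hpos := Finset.card_pos.2 ⟨_, hnil⟩
  rw [normalCodes, Finset.card_union_of_disjoint, Finset.card_image_of_injective _ (hinj _),
    Finset.card_image_of_injective _ (hinj _), Finset.card_insert_of_notMem,
    Nat.add_sub_cancel, Finset.card_erase_of_mem hnil, codes,
    Finset.card_insert_of_notMem (by simp), Finset.card_union_of_disjoint,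
    Finset.card_image_of_injective _ List.cons_injective,
    Finset.card_image_of_injective _ List.cons_injective]
  · omega
  · rw [Finset.disjoint_left]
    simp
  · simp [mem_codes]
  · rw [Finset.disjoint_left]
    simp

/-- The list of `k` entries `true` satisfies the length bound because `k ≤ l`. -/
theorem mem_normalCodes {k l : ℕ} (hk : 1 ≤ k) (hkl : k ≤ l) {i : Bool} {L : List Bool} :
    (i, L) ∈ normalCodes k l ↔ (L = [] → i = false) ∧ L.length ≤ l ∧
      L.count true + (if i = true ∧ false ∈ L then 1 else 0) ≤ k := by
  cases i
  · simp [normalCodes, mem_codes]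
  · by_cases hL : false ∈ L
    · have h1 : L ≠ List.replicate k true := by
        rintro rfl
        simp at hL
      have h2 : L ≠ [] := by
        rintro rfl
        simp at hL
      simp [normalCodes, mem_codes, h1, h2, hL]
      omega
    · have hrep : L = List.replicate L.length true := by
        refine List.eq_replicate_of_mem fun b hb => ?_
        cases b
        · exact absurd hb hL
        · rfl
      generalize L.length = n at hrep
      subst hrep
      simp [normalCodes, mem_codes]
      omega

theorem simpleProd_injOn {k l : ℕ} (hk : 1 ≤ k) (hkl : k ≤ l) :
    Set.InjOn (fun x : Bool × List Bool => simpleProd x.1 x.2) (normalCodes k l) := by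
  rintro ⟨i, L⟩ hx ⟨j, M⟩ hy h
  have h1 := nf_simpleProd i L
  have h2 := nf_simpleProd j M
  simp only at h
  rw [h, h2] at h1
  have h3 := congrArg Prod.snd h1
  rw [Finset.mem_coe, mem_normalCodes hk hkl] at hx hy
  rcases L with _ | ⟨b, L⟩ <;> rcases M with _ | ⟨c, M⟩ <;> simp only [Word.mk] at h3
  · rw [hx.1 rfl, hy.1 rfl]
  · cases h3
  · cases h3
  · cases h3
    rfl

theorem S_zero (l : ℕ) : S 0 l = {1} := by
  ext b
  simp only [S, Set.mem_ofPred_eq, pow_zero, Submonoid.coe_one, braidLE_one_iff,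
    Set.mem_singleton_iff, and_iff_left_iff_imp]
  rintro rfl
  exact complexity_le_iff.2 ⟨0, by simp, 1, by simp⟩

/-- The elements of `S (k + 1) (l + 1)` that `Δ_3` divides are the products of `Δ_3` with the
elements of `S k l`, since the order is invariant under left multiplication. -/
theorem S_succ {k l : ℕ} (hkl : k ≤ l) :
    S (k + 1) (l + 1) = (Delta3 * ·) '' S k l ∪
      (fun x : Bool × List Bool => simpleProd x.1 x.2) '' (normalCodes (k + 1) (l + 1)) := by
  have hDelta (b : positive 3) : Delta3 * b ∈ S (k + 1) (l + 1) ↔ b ∈ S k l := by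
    simp only [S, Set.mem_ofPred_eq, complexity_Delta3_mul_le_iff, pow_succ', Submonoid.coe_mul,
      braidLE_mul_left_iff]
  have hsimple (i : Bool) (L : List Bool) : simpleProd i L ∈ S (k + 1) (l + 1) ↔
      L.length ≤ l + 1 ∧ L.count true + (if i = true ∧ false ∈ L then 1 else 0) ≤ k + 1 := by
    rw [S, Set.mem_ofPred_eq, complexity_simpleProd_le_iff, simpleProd_braidLE_iff (by omega),
      and_comm]
  ext b
  constructor
  · intro hb
    rcases eq_Delta3_mul_or_eq_simpleProd b with ⟨b', rfl⟩ | ⟨i, L, rfl⟩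
    · exact Or.inl ⟨b', (hDelta b').1 hb, rfl⟩
    · rw [hsimple] at hb
      right
      by_cases hL : L = []
      · subst hL
        exact ⟨(false, []), (mem_normalCodes (by omega) (by omega)).2 (by simp), rfl⟩
      · exact ⟨(i, L), (mem_normalCodes (by omega) (by omega)).2 ⟨fun h => absurd h hL, hb⟩, rfl⟩
  · rintro (⟨b', hb', rfl⟩ | ⟨⟨i, L⟩, h, rfl⟩)
    · exact (hDelta b').2 hb'
    · exact (hsimple i L).2 ((mem_normalCodes (by omega) (by omega)).1 h).2

theorem S_finite {k l : ℕ} (hkl : k ≤ l) : (S k l).Finite := by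
  induction k generalizing l with
  | zero => rw [S_zero]; exact Set.finite_singleton 1
  | succ k ih =>
    obtain ⟨l, rfl⟩ := Nat.exists_eq_add_of_le' (show 1 ≤ l by omega)
    rw [S_succ (by omega)]
    exact ((ih (by omega)).image _).union ((Finset.finite_toSet _).image _)

theorem ncard_S_succ {k l : ℕ} (hkl : k ≤ l) :
    (S (k + 1) (l + 1)).ncard + 1 =
      (S k l).ncard + ∑ j ∈ Finset.range (k + 2), (l + 3).choose (j + 1) := by
  rw [S_succ hkl, Set.ncard_union_eq ?_ ((S_finite hkl).image _)
    ((Finset.finite_toSet _).image _),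
    Set.ncard_image_of_injective _ fun _ _ h => positive_mul_left_cancel h,
    (simpleProd_injOn (by omega) (by omega)).ncard_image, Set.ncard_coe_finset,
    add_assoc, card_normalCodes (by omega), card_codes]
  rw [Set.disjoint_left]
  rintro _ ⟨b, _, rfl⟩ ⟨x, _, hx⟩
  exact Delta3_mul_ne_simpleProd b x.1 x.2 hx.symm

theorem ncard_S {k l : ℕ} (hkl : k ≤ l) :
    (S k l).ncard + k = ∑ m ∈ Finset.range k, (l + 3).choose (m + 2) + 1 := by
  induction k generalizing l with
  | zero => simp [S_zero]
  | succ k ih =>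
    obtain ⟨l, rfl⟩ := Nat.exists_eq_add_of_le' (show 1 ≤ l by omega)
    have h1 := ncard_S_succ (show k ≤ l by omega)
    have h2 := ih (show k ≤ l by omega)
    have h3 (m : ℕ) : (l + 1 + 3).choose (m + 2) = (l + 3).choose (m + 1) + (l + 3).choose (m + 2) :=
      Nat.choose_succ_succ _ _
    simp only [h3, Finset.sum_add_distrib]
    rw [Finset.sum_range_succ, show k + 1 + 1 = k + 2 from rfl] at h1
    rw [Finset.sum_range_succ (fun m => (l + 3).choose (m + 2))]
    omega

/-! ### Polynomial growth -/

theorem ncard_S_le {k l : ℕ} (hk : 1 ≤ k) (hkl : k ≤ l) :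
    (S k l).ncard ≤ (l + 3) ^ (k + 2) := by
  have h1 := ncard_S hkl
  have h2 : ∑ m ∈ Finset.range k, (l + 3).choose (m + 2) ≤
      ∑ _m ∈ Finset.range k, (l + 3) ^ (k + 1) := by
    refine Finset.sum_le_sum fun m hm => (Nat.choose_le_pow _ _).trans ?_
    exact Nat.pow_le_pow_right (by omega) (by have := Finset.mem_range.1 hm; omega)
  rw [Finset.sum_const, Finset.card_range, smul_eq_mul] at h2
  calc (S k l).ncard ≤ k * (l + 3) ^ (k + 1) := by omega
    _ ≤ (l + 3) * (l + 3) ^ (k + 1) := Nat.mul_le_mul_right _ (by omega)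
    _ = (l + 3) ^ (k + 2) := by ring

open Polynomial

/-- The polynomial `X ↦ binom (X + 3) m`. -/
noncomputable def choosePoly (m : ℕ) : ℚ[X] :=
  C (1 / (m.factorial : ℚ)) * (descPochhammer ℚ m).comp (X + C 3)

theorem eval_choosePoly (m l : ℕ) : (choosePoly m).eval (l : ℚ) = ((l + 3).choose m : ℚ) := by
  have h : (l : ℚ) + 3 = ((l + 3 : ℕ) : ℚ) := by push_cast; rfl
  rw [choosePoly, eval_mul, eval_C, eval_comp, eval_add, eval_X, eval_C, h,
    descPochhammer_eval_eq_descFactorial, Nat.descFactorial_eq_factorial_mul_choose, Nat.cast_mul]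
  field_simp

theorem natDegree_choosePoly (m : ℕ) : (choosePoly m).natDegree = m := by
  rw [choosePoly, natDegree_C_mul (by positivity), natDegree_comp, natDegree_X_add_C, mul_one,
    descPochhammer_natDegree]

theorem leadingCoeff_choosePoly (m : ℕ) :
    (choosePoly m).leadingCoeff = 1 / (m.factorial : ℚ) := by
  rw [choosePoly, leadingCoeff_mul, leadingCoeff_C, leadingCoeff_comp (by simp),
    (monic_descPochhammer ℚ m).leadingCoeff, leadingCoeff_X_add_C]
  simp

/-- The polynomial that counts `S k l` for `k ≤ l`. -/
noncomputable def cardPoly (k : ℕ) : ℚ[X] :=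
  ∑ m ∈ Finset.range k, choosePoly (m + 2) + C (1 - (k : ℚ))

theorem eval_cardPoly {k l : ℕ} (hkl : k ≤ l) :
    (cardPoly k).eval (l : ℚ) = ((S k l).ncard : ℚ) := by
  have h := congrArg (Nat.cast (R := ℚ)) (ncard_S hkl)
  push_cast at h
  rw [cardPoly, eval_add, eval_finsetSum, eval_C]
  simp only [eval_choosePoly]
  linarith

/-- All terms of `cardPoly (k + 1)` but the last of its sum have smaller degree than that one. -/
theorem degree_cardPoly_sub_lt (k : ℕ) :
    (∑ m ∈ Finset.range k, choosePoly (m + 2) + C (1 - ((k + 1 : ℕ) : ℚ))).degree <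
      (choosePoly (k + 2)).degree := by
  have hne : choosePoly (k + 2) ≠ 0 := by
    intro h
    have := natDegree_choosePoly (k + 2)
    rw [h] at this
    simp at this
  rw [degree_eq_natDegree hne, natDegree_choosePoly]
  refine (degree_add_le _ _).trans_lt (max_lt ?_ ?_)
  · rw [degree_lt_iff_coeff_zero]
    intro n hn
    rw [finsetSum_coeff]
    refine Finset.sum_eq_zero fun m hm => coeff_eq_zero_of_natDegree_lt ?_
    rw [natDegree_choosePoly]
    have := Finset.mem_range.1 hm
    omega
  · exact degree_C_le.trans_lt (by exact_mod_cast Nat.succ_pos _)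

theorem cardPoly_succ (k : ℕ) : cardPoly (k + 1) =
    ∑ m ∈ Finset.range k, choosePoly (m + 2) + C (1 - ((k + 1 : ℕ) : ℚ)) +
      choosePoly (k + 2) := by
  rw [cardPoly, Finset.sum_range_succ]
  ring

theorem natDegree_cardPoly {k : ℕ} (hk : 1 ≤ k) : (cardPoly k).natDegree = k + 1 := by
  obtain ⟨k, rfl⟩ := Nat.exists_eq_add_of_le' hk
  rw [cardPoly_succ, natDegree_add_eq_right_of_degree_lt (degree_cardPoly_sub_lt k),
    natDegree_choosePoly]

theorem leadingCoeff_cardPoly {k : ℕ} (hk : 1 ≤ k) :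
    (cardPoly k).leadingCoeff = 1 / ((k + 1).factorial : ℚ) := by
  obtain ⟨k, rfl⟩ := Nat.exists_eq_add_of_le' hk
  rw [cardPoly_succ, leadingCoeff_add_of_degree_lt (degree_cardPoly_sub_lt k),
    leadingCoeff_choosePoly]

theorem eventually_half_le_eval {P : ℚ[X]} (hP : 0 < P.leadingCoeff) :
    ∀ᶠ l : ℕ in Filter.atTop,
      (1 / 2) * (P.leadingCoeff * (l : ℚ) ^ P.natDegree) ≤ P.eval (l : ℚ) := by
  have hne : P.leadingCoeff ≠ 0 := hP.ne'
  have h := P.div_tendsto_atTop_leadingCoeff_div_of_degree_eq (C P.leadingCoeff * X ^ P.natDegree)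
    (by rw [degree_C_mul_X_pow _ hne, degree_eq_natDegree (leadingCoeff_ne_zero.1 hne)])
  rw [leadingCoeff_C_mul_X_pow, div_self hne] at h
  have h' := (h.comp (tendsto_natCast_atTop_atTop (R := ℚ))).eventually
    (lt_mem_nhds (show (1 / 2 : ℚ) < 1 by norm_num))
  filter_upwards [h', Filter.eventually_gt_atTop 0] with l hl h0
  have hpos : 0 < P.leadingCoeff * (l : ℚ) ^ P.natDegree := by positivity
  simp only [Function.comp_apply, eval_mul, eval_C, eval_pow, eval_X] at hl
  exact ((lt_div_iff₀ hpos).1 hl).le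

end Braid

theorem proposition3p8 :
    (∀ k l : ℕ, 1 ≤ k → k ≤ l →
      (Braid.S k l).Finite ∧
      ((Braid.S k l).ncard : ℤ) =
        (∑ m ∈ Finset.Icc 1 k, ((l + 3).choose (m + 1) : ℤ)) - (k : ℤ) + 1 ∧
      (Braid.S k l).ncard ≤ (l + 3) ^ (k + 2)) ∧
    (∀ k : ℕ, 1 ≤ k →
      (∃ P : Polynomial ℚ, P.natDegree = k + 1 ∧
        P.leadingCoeff = 1 / ((k + 1).factorial : ℚ) ∧
        ∀ l : ℕ, k ≤ l → ((Braid.S k l).ncard : ℚ) = P.eval (l : ℚ)) ∧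
      (∀ᶠ l : ℕ in Filter.atTop,
        (1 / 2 : ℚ) * (l : ℚ) ^ (k + 1) / ((k + 1).factorial : ℚ) ≤ ((Braid.S k l).ncard : ℚ))) := by
  refine ⟨fun k l hk hkl => ⟨Braid.S_finite hkl, ?_, Braid.ncard_S_le hk hkl⟩, fun k hk =>
    ⟨⟨Braid.cardPoly k, Braid.natDegree_cardPoly hk, Braid.leadingCoeff_cardPoly hk,
      fun l hkl => (Braid.eval_cardPoly hkl).symm⟩, ?_⟩⟩
  · have h := congrArg (Nat.cast (R := ℤ)) (Braid.ncard_S hkl)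
    have hIcc : Finset.Icc 1 k = Finset.Ico 1 (k + 1) := rfl
    rw [hIcc, Finset.sum_Ico_eq_sum_range]
    simp only [Nat.add_sub_cancel, show ∀ m, 1 + m + 1 = m + 2 by omega]
    push_cast at h
    linarith
  · have h := Braid.eventually_half_le_eval (P := Braid.cardPoly k)
      (by rw [Braid.leadingCoeff_cardPoly hk]; positivity)
    filter_upwards [h, Filter.eventually_ge_atTop k] with l hl hkl
    rw [Braid.leadingCoeff_cardPoly hk, Braid.natDegree_cardPoly hk, Braid.eval_cardPoly hkl] at hl
    calc _ = _ := by ring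
      _ ≤ _ := hl
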